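/- Let $m,n,L\ge 0$ be integers, $N=m+n$, $\xi\in\mathbb C$. Let $a$ be an auxiliary space $\mathbb C^N$ and let $1,\dots,L$ label the factors of the quantum space $(\mathbb C^N)^{\otimes L}$. Write $E_{\alpha\beta}$ for the elementary matrices, $\mathcal P_{aj}=\sum_{\alpha,\beta}(E_{\alpha\beta})_a(E_{\beta\alpha})_j$, $R_{aj}(\lambda)=\lambda\,\mathbb I+i\mathcal P_{aj}$, $R_{ja}(\lambda)=\lambda\,\mathbb I+i\mathcal P_{ja}$, $\mathbb E=\mathrm{diag}(\underbrace{1,\dots,1}_m,\underbrace{-1,\dots,-1}_n)$ and $K^-(\lambda)=i\xi\,\mathbb I+\lambda\mathbb E$, $K^+(\lambda)=\mathbb I$. Define the monodromy matrix and the (soliton preserving) transfer matrix by $$\mathcal T_a(\lambda)=R_{aL}(\lambda)\cdots R_{a1}(\lambda)\,K^-_a(\lambda)\,R_{1a}(\lambda)\cdots R_{La}(\lambda),\qquad t(\lambda)=\mathrm{Tr}_a\,K_a^+(\lambda)\mathcal T_a(\lambda).$$ Put $\mathcal B_{aj}=\mathcal P_{aj}\mathbb E_a+\mathbb E_a\mathcal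 P_{aj}$ and define the operators $b_j^{\alpha\beta}$ (acting on the $j$-th factor of the quantum space) by $\mathcal B_{aj}=\sum_{\alpha,\beta}E_{\alpha\beta}\otimes b_j^{\alpha\beta}$. Then: 1. As $|\lambda|\to\infty$ in $\mathbb C$, $$\mathcal T_a(\lambda)=\lambda^{2L+1}\Big(\mathbb E_a+\frac i\lambda\Big(\xi+\sum_{j=1}^L\mathcal B_{aj}\Big)+O(\lambda^{-2})\Big).$$ 2. For each $j$, the operators $b_j^{\alpha\beta}$ realise $gl(m)\oplus gl(n)$ in the space $j$: the map sending $(X,Y)\in gl(m)\oplus gl(n)$ to the block-diagonal matrix $\mathrm{diag}(X,Y)$ acting on the $j$-th factor is an injective homomorphism of Lie algebras, and its image is the linear span of the $b_j^{\alpha\beta}$, $1\le\alpha,\beta\le N$. 3. For all $\lambda\in\mathbb C$ and all $\alpha,\beta$, $$\Big[\,t(\lambda),\ \sum_{j=1}^L b_j^{\alpha\beta}\Big]=0 .$$ That is, $t(\lambda)$ commutes with $gl(m)\oplus gl(n)$: the map $(X,Y)\mapsto\sum_{j=1}^L \mathrm{diag}(X,Y)_j$ is a homomorphism of Lie algebras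 (injective if $L\ge1$), its image is the linear span of the total generators $\sum_j b_j^{\alpha\beta}$, and $t(\lambda)$ commutes with every element of this image. -/

import Mathlib

open scoped Kronecker

attribute [local instance 100] LieRing.ofAssociativeRing

noncomputable section

namespace OpenChain

variable {ι : Type} [Fintype ι] [DecidableEq ι] {L : ℕ}

/-- Operators on the quantum space `(ℂ^ι)^{⊗ L}` of a chain with `L` sites, as matrices in the
tensor-product basis, which is indexed by the configurations `Fin L → ι`. -/
abbrev QOp (ι : Type) (L : ℕ) : Type := Matrix (Fin L → ι) (Fin L → ι) ℂ

/-- Operators on (auxiliary space `a`) `⊗` (quantum space), that is on `ℂ^ι ⊗ (ℂ^ι)^{⊗ L}`. -/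
abbrev AQOp (ι : Type) (L : ℕ) : Type := Matrix (ι × (Fin L → ι)) (ι × (Fin L → ι)) ℂ

/-- The one-site matrix `A` acting on the `j`-th factor of the quantum space:
`1 ⊗ ⋯ ⊗ 1 ⊗ A ⊗ 1 ⊗ ⋯ ⊗ 1`. -/
def siteOp (j : Fin L) (A : Matrix ι ι ℂ) : QOp ι L :=
  Matrix.of fun x y => A (x j) (y j) * if ∀ k, k ≠ j → x k = y k then 1 else 0

/-- The matrix `A` acting on the auxiliary space, `A_a = A ⊗ 1`. -/
def auxOp (L : ℕ) (A : Matrix ι ι ℂ) : AQOp ι L := A ⊗ₖ (1 : QOp ι L)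

/-- The permutation operator `P_{aj} = ∑ E_{αβ} ⊗ E_{βα}`, first factor in the auxiliary space,
second factor in the `j`-th site. -/
def permAS (j : Fin L) : AQOp ι L :=
  ∑ α : ι, ∑ β : ι, Matrix.single α β (1 : ℂ) ⊗ₖ siteOp j (Matrix.single β α (1 : ℂ))

/-- The permutation operator `P_{ja}`: as `permAS`, with the roles of the two spaces exchanged. -/
def permSA (j : Fin L) : AQOp ι L :=
  ∑ α : ι, ∑ β : ι, Matrix.single β α (1 : ℂ) ⊗ₖ siteOp j (Matrix.single α β (1 : ℂ))

/-- `R_{aj}(lam) = lam 𝕀 + i P_{aj}`. -/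
def RAS (lam : ℂ) (j : Fin L) : AQOp ι L := lam • (1 : AQOp ι L) + Complex.I • permAS j

/-- `R_{ja}(lam) = lam 𝕀 + i P_{ja}`. -/
def RSA (lam : ℂ) (j : Fin L) : AQOp ι L := lam • (1 : AQOp ι L) + Complex.I • permSA j

/-- `T_a(lam) = R_{aL}(lam) ⋯ R_{a1}(lam)`. -/
def bulkT (ι : Type) [Fintype ι] [DecidableEq ι] (L : ℕ) (lam : ℂ) : AQOp ι L :=
  (List.ofFn fun j : Fin L => RAS (ι := ι) lam j).reverse.prod

/-- `T̂_a(lam) = R_{1a}(lam) ⋯ R_{La}(lam)`. -/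
def bulkTHat (ι : Type) [Fintype ι] [DecidableEq ι] (L : ℕ) (lam : ℂ) : AQOp ι L :=
  (List.ofFn fun j : Fin L => RSA (ι := ι) lam j).prod

/-- The double-row monodromy matrix `𝒯_a(lam) = T_a(lam) K⁻_a(lam) T̂_a(lam)`. -/
def monodromy (L : ℕ) (Kminus : ℂ → Matrix ι ι ℂ) (lam : ℂ) : AQOp ι L :=
  bulkT ι L lam * auxOp L (Kminus lam) * bulkTHat ι L lam

/-- Partial trace over the auxiliary space. -/
def auxTrace (M : AQOp ι L) : QOp ι L :=
  Matrix.of fun x y => ∑ α : ι, M (α, x) (α, y)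

/-- The transfer matrix `t(lam) = Tr_a K⁺_a(lam) 𝒯_a(lam)`. -/
def transfer (L : ℕ) (Kplus Kminus : ℂ → Matrix ι ι ℂ) (lam : ℂ) : QOp ι L :=
  auxTrace (auxOp L (Kplus lam) * monodromy L Kminus lam)

/-- The `(α, β)` component of an operator with respect to the auxiliary space. -/
def auxComp (M : AQOp ι L) (α β : ι) : QOp ι L :=
  Matrix.of fun x y => M (α, x) (β, y)

/-- An operator is recovered from its components: `M = ∑ E_{αβ} ⊗ M^{αβ}`. -/
theorem eq_sum_auxComp (M : AQOp ι L) :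
    M = ∑ α : ι, ∑ β : ι, Matrix.single α β (1 : ℂ) ⊗ₖ auxComp M α β := by
  ext ⟨a, x⟩ ⟨b, y⟩
  simp [Matrix.sum_apply, Matrix.single_apply, auxComp, ite_and]

/-- `𝔼 = diag(+1, …, +1, -1, …, -1)` with `m` entries `+1` followed by `n` entries `-1`. -/
def signE (m n : ℕ) : Matrix (Fin m ⊕ Fin n) (Fin m ⊕ Fin n) ℂ :=
  Matrix.diagonal (Sum.elim (fun _ => 1) (fun _ => -1))

/-- `K⁻(lam) = i ξ 𝕀 + lam 𝔼`. -/
def Kdiag (m n : ℕ) (ξ lam : ℂ) : Matrix (Fin m ⊕ Fin n) (Fin m ⊕ Fin n) ℂ :=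
  (Complex.I * ξ) • (1 : Matrix (Fin m ⊕ Fin n) (Fin m ⊕ Fin n) ℂ) + lam • signE m n

/-- `ℬ_{aj} = P_{aj} 𝔼_a + 𝔼_a P_{aj}`. -/
def calB (m n : ℕ) (j : Fin L) : AQOp (Fin m ⊕ Fin n) L :=
  permAS j * auxOp L (signE m n) + auxOp L (signE m n) * permAS j

/-- The operators `b_j^{αβ}`, defined by `ℬ_{aj} = ∑ E_{αβ} ⊗ b_j^{αβ}`. -/
def genb (m n : ℕ) (j : Fin L) (α β : Fin m ⊕ Fin n) : QOp (Fin m ⊕ Fin n) L :=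
  auxComp (calB m n j) α β

/-- The Lie algebra `gl(m) ⊕ gl(n)` embedded in `gl(m + n)` as block-diagonal matrices. -/
def blockDiag {m n : ℕ} (z : Matrix (Fin m) (Fin m) ℂ × Matrix (Fin n) (Fin n) ℂ) :
    Matrix (Fin m ⊕ Fin n) (Fin m ⊕ Fin n) ℂ :=
  Matrix.fromBlocks z.1 0 0 z.2

end OpenChain

end

open OpenChain

set_option linter.unusedSectionVars false

namespace OpenChain

/-! ### One-site operators on the chain and their diagonal action -/

section Site

variable {ι : Type} [Fintype ι] [DecidableEq ι] {L : ℕ}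

/-! The symmetry needs neither the Yang–Baxter nor the reflection equation. Since `P_{aj}` exchanges
the spaces `a` and `j`, every R-matrix commutes with `A_a + ∑ j, A_j` (`permAS_commute_fullOp`). So
does `K⁻_a` when `A` commutes with `K⁻`, hence so does the monodromy matrix. Under the partial trace
the `A_a` terms cancel by cyclicity, so `t(lam)` commutes with `∑ j, A_j`
(`auxTrace_commute_totalOp`). Block-diagonal `A` qualify because `𝔼` is scalar on each block.

The generators are explicit: `b_j^{αβ} = (ε_α + ε_β) E_{βα}` at site `j`, with `ε` the diagonal of
`𝔼` (`genb_eq`). The coefficient is `±2` inside a block and `0` across blocks, so their span is the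
block-diagonal algebra (`range_blockDiagLie`).

For the expansion, each of the `2L + 1` factors is divided by `lam`, which makes it affine in `μ = 1
/ lam`, and the product is expanded to first order at `μ = 0` (`hasExpansion_monodromy`). -/

theorem siteOp_apply (j : Fin L) (A : Matrix ι ι ℂ) (x y : Fin L → ι) :
    siteOp j A x y = A (x j) (y j) * if ∀ k, k ≠ j → x k = y k then 1 else 0 := rfl

theorem eq_update_iff (j : Fin L) (x z : Fin L → ι) (c : ι) :
    z = Function.update x j c ↔ z j = c ∧ ∀ k, k ≠ j → x k = z k := by
  rw [Function.eq_update_iff]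
  exact and_congr_right fun _ => forall_congr' fun k => imp_congr_right fun _ => eq_comm

/-- A sum over the configurations that agree with `x` away from the site `j`. -/
theorem sum_agree_mul (j : Fin L) (x : Fin L → ι) (f : (Fin L → ι) → ℂ) :
    ∑ z, (if ∀ k, k ≠ j → x k = z k then 1 else 0) * f z =
      ∑ c, f (Function.update x j c) := by
  have h : ∀ c, f (Function.update x j c) =
      ∑ z, if z = Function.update x j c then f z else 0 := fun c => by simp
  simp_rw [h]
  rw [Finset.sum_comm]
  refine Finset.sum_congr rfl fun z _ => ?_
  simp_rw [eq_update_iff]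
  by_cases hz : ∀ k, k ≠ j → x k = z k
  · simp [if_pos hz, and_iff_left hz]
  · simp [hz]

theorem siteOp_mul_apply (j : Fin L) (A : Matrix ι ι ℂ) (M : QOp ι L) (x y : Fin L → ι) :
    (siteOp j A * M) x y = ∑ c, A (x j) c * M (Function.update x j c) y := by
  have h := sum_agree_mul j x fun z => A (x j) (z j) * M z y
  simp only [Function.update_self] at h
  rw [← h, Matrix.mul_apply]
  exact Finset.sum_congr rfl fun z _ => by rw [siteOp_apply]; ring

theorem siteOp_one (j : Fin L) : siteOp j (1 : Matrix ι ι ℂ) = 1 := by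
  ext x y
  rw [siteOp_apply, Matrix.one_apply, Matrix.one_apply]
  have : x = y ↔ x j = y j ∧ ∀ k, k ≠ j → x k = y k := by
    constructor
    · rintro rfl; simp
    · rintro ⟨h, h'⟩
      ext k
      by_cases hk : k = j
      · rw [hk, h]
      · exact h' k hk
  simp only [this, ite_and]
  split_ifs <;> simp

theorem siteOp_mul (j : Fin L) (A B : Matrix ι ι ℂ) :
    siteOp j (A * B) = siteOp j A * siteOp j B := by
  ext x y
  rw [siteOp_mul_apply, siteOp_apply, Matrix.mul_apply, Finset.sum_mul]
  refine Finset.sum_congr rfl fun c _ => ?_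
  rw [siteOp_apply, Function.update_self, mul_assoc]
  congr 3
  exact propext (forall_congr' fun k => imp_congr_right fun hk => by
    rw [Function.update_of_ne hk])

/-- The action of one-site matrices on the `j`-th site as a homomorphism of algebras. -/
def siteHom (j : Fin L) : Matrix ι ι ℂ →ₐ[ℂ] QOp ι L :=
  AlgHom.ofLinearMap
    { toFun := siteOp j
      map_add' := fun A B => by ext x y; exact add_mul _ _ _
      map_smul' := fun c A => by ext x y; exact mul_assoc _ _ _ }
    (siteOp_one j) (siteOp_mul j)

theorem siteHom_apply (j : Fin L) (A : Matrix ι ι ℂ) : siteHom j A = siteOp j A := rfl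

/-- The formula is symmetric under exchange of `(j, A)` and `(k, B)`, which gives commutation at
distinct sites. -/
theorem siteOp_mul_siteOp_apply {j k : Fin L} (hjk : j ≠ k) (A B : Matrix ι ι ℂ)
    (x y : Fin L → ι) :
    (siteOp j A * siteOp k B) x y =
      A (x j) (y j) * B (x k) (y k) * if ∀ l, l ≠ j → l ≠ k → x l = y l then 1 else 0 := by
  rw [siteOp_mul_apply, Finset.sum_eq_single (y j)]
  · rw [siteOp_apply, Function.update_of_ne hjk.symm, mul_assoc]
    congr 3
    refine propext (forall_congr' fun l => ?_)
    by_cases hl : l = j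
    · subst hl; simp
    · simp [hl]
  · intro c _ hc
    rw [siteOp_apply, if_neg]
    · simp
    · intro h
      exact hc (by simpa using h j hjk)
  · simp

theorem siteOp_commute {j k : Fin L} (hjk : j ≠ k) (A B : Matrix ι ι ℂ) :
    Commute (siteOp j A) (siteOp k B) := by
  ext x y
  rw [siteOp_mul_siteOp_apply hjk, siteOp_mul_siteOp_apply hjk.symm, mul_comm (A _ _)]
  congr 2
  exact propext (forall_congr' fun l => imp.swap)

/-- The diagonal action `A ↦ ∑ j, A_j` of one-site matrices on the chain. -/
def totalOp (ι : Type) [Fintype ι] [DecidableEq ι] (L : ℕ) : Matrix ι ι ℂ →ₗ[ℂ] QOp ι L :=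
  ∑ j : Fin L, (siteHom j).toLinearMap

theorem totalOp_apply (A : Matrix ι ι ℂ) : totalOp ι L A = ∑ j : Fin L, siteOp j A := by
  simp [totalOp, siteHom_apply]

theorem totalOp_lie (A B : Matrix ι ι ℂ) :
    totalOp ι L ⁅A, B⁆ = ⁅totalOp ι L A, totalOp ι L B⁆ := by
  simp only [totalOp_apply]
  rw [Ring.lie_def (∑ j : Fin L, siteOp j A), Finset.sum_mul_sum, Finset.sum_mul_sum,
    Finset.sum_comm (f := fun i j => siteOp i B * siteOp j A), ← Finset.sum_sub_distrib]
  refine Finset.sum_congr rfl fun j _ => ?_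
  rw [← Finset.sum_sub_distrib, Finset.sum_eq_single j]
  · rw [Ring.lie_def, ← siteHom_apply, map_sub, map_mul, map_mul]
    rfl
  · intro k _ hk
    rw [(siteOp_commute hk.symm A B).eq, sub_self]
  · simp

theorem siteHom_injective (j : Fin L) : Function.Injective (siteHom (ι := ι) j) := by
  intro A B h
  ext a b
  -- The entry between these two configurations, which agree away from `j`, is exactly `A a b`.
  have := congrFun (congrFun h fun _ => a) (Function.update (fun _ => a) j b)
  simp only [siteHom_apply, siteOp_apply, Function.update_self] at this
  have hone : ∀ k, k ≠ j → a = Function.update (fun _ => a) j b k :=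
    fun k hk => (Function.update_of_ne hk b fun _ => a).symm
  simpa only [if_pos hone, mul_one] using this

theorem totalOp_injective (hL : 1 ≤ L) : Function.Injective (totalOp ι L) := by
  rw [← LinearMap.ker_eq_bot, LinearMap.ker_eq_bot']
  intro A h
  rw [totalOp_apply] at h
  ext a b
  have key := congrFun (congrFun h fun _ => a) (Function.update (fun _ => a) ⟨0, hL⟩ b)
  simp only [Matrix.sum_apply, siteOp_apply] at key
  -- On the diagonal every site contributes, giving `L * A a a`; off the diagonal only site `0`
  -- does, giving `A a b`.
  by_cases hab : a = b
  · subst hab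
    have hL' : (L : ℂ) ≠ 0 := by exact_mod_cast (by omega : L ≠ 0)
    simpa [hL'] using key
  · rw [Finset.sum_eq_single ⟨0, hL⟩] at key
    · have hone : ∀ k : Fin L, k ≠ ⟨0, hL⟩ →
          a = Function.update (fun _ => a) ⟨0, hL⟩ b k :=
        fun k hk => (Function.update_of_ne hk b fun _ => a).symm
      rw [if_pos hone, Function.update_self, mul_one] at key
      exact key
    · intro k _ hk
      rw [if_neg, mul_zero]
      intro h'
      exact hab (by simpa using h' ⟨0, hL⟩ hk.symm)
    · simp

end Site

/-! ### Auxiliary space and symmetry of the transfer matrix -/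

section Aux

variable {ι : Type} [Fintype ι] [DecidableEq ι] {L : ℕ}

theorem ext_auxComp {M N : AQOp ι L} (h : ∀ α β, auxComp M α β = auxComp N α β) : M = N := by
  ext ⟨a, x⟩ ⟨b, y⟩
  exact congrFun (congrFun (h a b) x) y

theorem auxComp_add (M N : AQOp ι L) (α β : ι) :
    auxComp (M + N) α β = auxComp M α β + auxComp N α β := rfl

theorem auxComp_auxOp_mul (A : Matrix ι ι ℂ) (M : AQOp ι L) (α β : ι) :
    auxComp (auxOp L A * M) α β = ∑ γ, A α γ • auxComp M γ β := by
  ext x y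
  simp [auxComp, auxOp, Matrix.mul_apply, Matrix.sum_apply, Fintype.sum_prod_type,
    Matrix.one_apply]

theorem auxComp_mul_auxOp (A : Matrix ι ι ℂ) (M : AQOp ι L) (α β : ι) :
    auxComp (M * auxOp L A) α β = ∑ γ, A γ β • auxComp M α γ := by
  ext x y
  simp [auxComp, auxOp, Matrix.mul_apply, Matrix.sum_apply, Fintype.sum_prod_type,
    Matrix.one_apply, mul_comm]

/-- An operator on the quantum space, acting trivially on the auxiliary space. -/
def quantOp (Q : QOp ι L) : AQOp ι L := (1 : Matrix ι ι ℂ) ⊗ₖ Q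

theorem auxComp_quantOp_mul (Q : QOp ι L) (M : AQOp ι L) (α β : ι) :
    auxComp (quantOp Q * M) α β = Q * auxComp M α β := by
  ext x y
  simp [auxComp, quantOp, Matrix.mul_apply, Fintype.sum_prod_type, Matrix.one_apply]

theorem auxComp_mul_quantOp (Q : QOp ι L) (M : AQOp ι L) (α β : ι) :
    auxComp (M * quantOp Q) α β = auxComp M α β * Q := by
  ext x y
  simp [auxComp, quantOp, Matrix.mul_apply, Fintype.sum_prod_type, Matrix.one_apply]

theorem quantOp_sum {κ : Type} (s : Finset κ) (f : κ → QOp ι L) :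
    quantOp (∑ j ∈ s, f j) = ∑ j ∈ s, quantOp (f j) := by
  ext ⟨a, x⟩ ⟨b, y⟩
  simp [quantOp, Matrix.sum_apply, Finset.mul_sum]

theorem auxComp_permAS (j : Fin L) (α β : ι) :
    auxComp (permAS j) α β = siteOp j (Matrix.single β α 1) := by
  ext x y
  simp [auxComp, permAS, Matrix.sum_apply, Matrix.single_apply, ite_and]

theorem permSA_eq_permAS (j : Fin L) : permSA (ι := ι) j = permAS j :=
  Finset.sum_comm

/-- Compared on auxiliary components, both sides are `A E_{βα}` at site `j`. -/
theorem permAS_mul_auxOp (j : Fin L) (A : Matrix ι ι ℂ) :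
    permAS j * auxOp L A = quantOp (siteOp j A) * permAS j := by
  refine ext_auxComp fun α β => ?_
  rw [auxComp_mul_auxOp, auxComp_quantOp_mul, auxComp_permAS, ← siteOp_mul]
  simp only [auxComp_permAS, ← siteHom_apply, ← map_smul, ← map_sum]
  congr 1
  ext a b
  simp [Matrix.sum_apply, Matrix.mul_apply, Matrix.single_apply, ite_and]

theorem auxOp_mul_permAS (j : Fin L) (A : Matrix ι ι ℂ) :
    auxOp L A * permAS j = permAS j * quantOp (siteOp j A) := by
  refine ext_auxComp fun α β => ?_
  rw [auxComp_auxOp_mul, auxComp_mul_quantOp, auxComp_permAS, ← siteOp_mul]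
  simp only [auxComp_permAS, ← siteHom_apply, ← map_smul, ← map_sum]
  congr 1
  ext a b
  simp [Matrix.sum_apply, Matrix.mul_apply, Matrix.single_apply, ite_and]

theorem permAS_commute_quantOp {j k : Fin L} (hjk : j ≠ k) (A : Matrix ι ι ℂ) :
    Commute (permAS j) (quantOp (siteOp k A)) := by
  refine ext_auxComp fun α β => ?_
  rw [auxComp_mul_quantOp, auxComp_quantOp_mul, auxComp_permAS]
  exact siteOp_commute hjk _ _

theorem auxOp_mul_auxOp (A B : Matrix ι ι ℂ) : auxOp L A * auxOp L B = auxOp L (A * B) := by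
  simp [auxOp, ← Matrix.mul_kronecker_mul]

theorem auxOp_commute_quantOp (A : Matrix ι ι ℂ) (Q : QOp ι L) :
    Commute (auxOp L A) (quantOp Q) := by
  simp [Commute, SemiconjBy, auxOp, quantOp, ← Matrix.mul_kronecker_mul]

theorem auxOp_one : auxOp L (1 : Matrix ι ι ℂ) = 1 := by
  simp [auxOp]

/-- The one-site matrix `A` acting on the auxiliary space and on all the sites. -/
def fullOp (L : ℕ) (A : Matrix ι ι ℂ) : AQOp ι L := auxOp L A + quantOp (totalOp ι L A)

theorem permAS_commute_fullOp (j : Fin L) (A : Matrix ι ι ℂ) :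
    Commute (permAS j) (fullOp L A) := by
  -- Only `A_a + A_j` meets `P_{aj}`, which swaps its two terms; the other sites commute with it.
  rw [fullOp, totalOp_apply, quantOp_sum, ← Finset.add_sum_erase _ _ (Finset.mem_univ j),
    ← add_assoc]
  refine Commute.add_right ?_ (Commute.sum_right _ _ _ fun k hk =>
    permAS_commute_quantOp (Finset.ne_of_mem_erase hk).symm A)
  rw [Commute, SemiconjBy, mul_add, add_mul, permAS_mul_auxOp, auxOp_mul_permAS, add_comm]

theorem RAS_commute_fullOp (lam : ℂ) (j : Fin L) (A : Matrix ι ι ℂ) :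
    Commute (RAS lam j) (fullOp L A) :=
  ((Commute.one_left _).smul_left _).add_left ((permAS_commute_fullOp j A).smul_left _)

theorem RSA_eq_RAS (lam : ℂ) (j : Fin L) : RSA (ι := ι) lam j = RAS lam j := by
  rw [RSA, RAS, permSA_eq_permAS]

theorem monodromy_commute_fullOp (K : ℂ → Matrix ι ι ℂ) (lam : ℂ) (A : Matrix ι ι ℂ)
    (hK : Commute (K lam) A) : Commute (monodromy L K lam) (fullOp L A) := by
  refine Commute.mul_left (Commute.mul_left ?_ ?_) ?_
  · refine Commute.list_prod_left _ _ fun M hM => ?_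
    obtain ⟨j, rfl⟩ := List.mem_ofFn.1 (List.mem_reverse.1 hM)
    exact RAS_commute_fullOp lam j A
  · refine Commute.add_right ?_ (auxOp_commute_quantOp _ _)
    rw [Commute, SemiconjBy, auxOp_mul_auxOp, auxOp_mul_auxOp, hK.eq]
  · refine Commute.list_prod_left _ _ fun M hM => ?_
    obtain ⟨j, rfl⟩ := List.mem_ofFn.1 hM
    rw [RSA_eq_RAS]
    exact RAS_commute_fullOp lam j A

theorem auxTrace_eq_sum (M : AQOp ι L) : auxTrace M = ∑ α, auxComp M α α := by
  ext x y
  simp [auxTrace, auxComp, Matrix.sum_apply]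

theorem auxTrace_add (M N : AQOp ι L) : auxTrace (M + N) = auxTrace M + auxTrace N := by
  simp only [auxTrace_eq_sum, auxComp_add, Finset.sum_add_distrib]

theorem auxTrace_auxOp_mul (A : Matrix ι ι ℂ) (M : AQOp ι L) :
    auxTrace (auxOp L A * M) = auxTrace (M * auxOp L A) := by
  simp only [auxTrace_eq_sum, auxComp_auxOp_mul, auxComp_mul_auxOp]
  exact Finset.sum_comm

/-- The trace over `a` is cyclic for operators `A_a`, so these cancel, while quantum operators
factor out of it. -/
theorem auxTrace_commute_totalOp {M : AQOp ι L} {A : Matrix ι ι ℂ}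
    (h : Commute M (fullOp L A)) : Commute (auxTrace M) (totalOp ι L A) := by
  have h' := congrArg auxTrace h.eq
  rw [fullOp, mul_add, add_mul, auxTrace_add, auxTrace_add, auxTrace_auxOp_mul,
    add_right_inj] at h'
  simp only [auxTrace_eq_sum, auxComp_mul_quantOp, auxComp_quantOp_mul, ← Finset.sum_mul,
    ← Finset.mul_sum] at h'
  rwa [Commute, SemiconjBy, auxTrace_eq_sum]

theorem transfer_commute_totalOp (K : ℂ → Matrix ι ι ℂ) (lam : ℂ) (A : Matrix ι ι ℂ)
    (hK : Commute (K lam) A) :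
    Commute (transfer L (fun _ => 1) K lam) (totalOp ι L A) := by
  refine auxTrace_commute_totalOp ?_
  rw [auxOp_one, one_mul]
  exact monodromy_commute_fullOp K lam A hK

end Aux

/-! ### First-order expansions of matrix products -/

section Expansion

variable {κ : Type} [Fintype κ] [DecidableEq κ]

/-- `G μ = A + μ B + O(μ²)` at `μ = 0`, with a remainder `μ² C(μ)`, `C` continuous. -/
def HasExpansion (G : ℂ → Matrix κ κ ℂ) (A B : Matrix κ κ ℂ) : Prop :=
  ∃ C : ℂ → Matrix κ κ ℂ, Continuous C ∧ ∀ μ, G μ = A + μ • B + μ ^ 2 • C μ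

theorem hasExpansion_linear (A B : Matrix κ κ ℂ) : HasExpansion (fun μ => A + μ • B) A B :=
  ⟨0, continuous_const, fun μ => by simp⟩

theorem HasExpansion.mul {G G' : ℂ → Matrix κ κ ℂ} {A B A' B' : Matrix κ κ ℂ}
    (h : HasExpansion G A B) (h' : HasExpansion G' A' B') :
    HasExpansion (fun μ => G μ * G' μ) (A * A') (A * B' + B * A') := by
  obtain ⟨C, hC, hG⟩ := h
  obtain ⟨C', hC', hG'⟩ := h'
  -- The terms of order `μ²`, `μ³` and `μ⁴` of the product, divided by `μ²`.
  refine ⟨fun μ => A * C' μ + B * B' + C μ * A' + μ • (B * C' μ + C μ * B')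
    + μ ^ 2 • (C μ * C' μ), by fun_prop, fun μ => ?_⟩
  simp only [hG, hG', add_mul, mul_add, smul_mul_assoc, mul_smul_comm, smul_add, smul_smul]
  module

theorem hasExpansion_list_prod (l : List (Matrix κ κ ℂ)) :
    HasExpansion (fun μ => (l.map fun P => 1 + μ • P).prod) 1 l.sum := by
  induction l with
  | nil => simpa using hasExpansion_linear (1 : Matrix κ κ ℂ) 0
  | cons P l ih =>
    have := (hasExpansion_linear 1 P).mul ih
    simpa [add_comm] using this

/-- The remainder is `lam⁻² C(lam⁻¹)`, and continuity of `C` at `0` keeps `C(lam⁻¹)` bounded near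
infinity. -/
theorem HasExpansion.isBigO {G : ℂ → Matrix κ κ ℂ} {A B : Matrix κ κ ℂ}
    (h : HasExpansion G A B) (p q : κ) :
    (fun lam : ℂ => G lam⁻¹ p q - (A + lam⁻¹ • B) p q)
      =O[Bornology.cobounded ℂ] fun lam : ℂ => (lam ^ 2)⁻¹ := by
  obtain ⟨C, hC, hG⟩ := h
  have hlim : Filter.Tendsto (fun lam : ℂ => C lam⁻¹ p q) (Bornology.cobounded ℂ)
      (nhds (C 0 p q)) :=
    ((hC.matrix_elem p q).tendsto 0).comp Filter.tendsto_inv₀_cobounded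
  have := (Asymptotics.isBigO_refl (fun lam : ℂ => (lam ^ 2)⁻¹) (Bornology.cobounded ℂ)).mul
    (hlim.isBigO_one ℂ)
  simp only [mul_one] at this
  refine this.congr_left fun lam => ?_
  simp [hG]

theorem list_prod_smul (l : List (Matrix κ κ ℂ)) (c : ℂ) :
    (l.map fun M => c • M).prod = c ^ l.length • l.prod := by
  induction l with
  | nil => simp
  | cons M l ih => simp [ih, pow_succ, smul_smul]

end Expansion

/-! ### Expansion of the monodromy matrix and the block-diagonal algebra -/

section BlockDiag

variable {m n L : ℕ}

theorem RAS_eq_smul {ι : Type} [Fintype ι] [DecidableEq ι] {lam : ℂ} (hlam : lam ≠ 0)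
    (j : Fin L) :
    RAS (ι := ι) lam j = lam • (1 + lam⁻¹ • (Complex.I • permAS j)) := by
  rw [RAS, smul_add, smul_smul lam, mul_inv_cancel₀ hlam, one_smul]

theorem hasExpansion_monodromy (m n L : ℕ) (ξ : ℂ) :
    ∃ G, HasExpansion G (auxOp L (signE m n))
        (Complex.I • (ξ • (1 : AQOp (Fin m ⊕ Fin n) L) + ∑ j : Fin L, calB m n j)) ∧
      ∀ lam : ℂ, lam ≠ 0 →
        (lam ^ (2 * L + 1))⁻¹ • monodromy L (Kdiag m n ξ) lam = G lam⁻¹ := by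
  let l : List (AQOp (Fin m ⊕ Fin n) L) := List.ofFn fun j : Fin L => Complex.I • permAS j
  have h := ((hasExpansion_list_prod l.reverse).mul (hasExpansion_linear
    (auxOp L (signE m n)) ((Complex.I * ξ) • 1))).mul (hasExpansion_list_prod l)
  refine ⟨fun μ => (l.reverse.map fun P => 1 + μ • P).prod *
    (auxOp L (signE m n) + μ • ((Complex.I * ξ) • 1)) * (l.map fun P => 1 + μ • P).prod,
    ?_, fun lam hlam => ?_⟩
  rotate_left
  · have e1 : bulkT (Fin m ⊕ Fin n) L lam =
        lam ^ L • (l.reverse.map fun P => 1 + lam⁻¹ • P).prod := by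
      rw [bulkT]
      have : (List.ofFn fun j : Fin L => RAS (ι := Fin m ⊕ Fin n) lam j) =
          (l.map fun P => 1 + lam⁻¹ • P).map fun M => lam • M := by
        simp only [l, List.map_ofFn]
        exact congrArg _ (funext fun j => RAS_eq_smul hlam j)
      rw [this, ← List.map_reverse, list_prod_smul, ← List.map_reverse]
      simp [l]
    have e2 : bulkTHat (Fin m ⊕ Fin n) L lam =
        lam ^ L • (l.map fun P => 1 + lam⁻¹ • P).prod := by
      rw [bulkTHat]
      have : (List.ofFn fun j : Fin L => RSA (ι := Fin m ⊕ Fin n) lam j) =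
          (l.map fun P => 1 + lam⁻¹ • P).map fun M => lam • M := by
        simp only [l, List.map_ofFn, RSA_eq_RAS]
        exact congrArg _ (funext fun j => RAS_eq_smul hlam j)
      rw [this, list_prod_smul]
      simp [l]
    have e3 : auxOp L (Kdiag m n ξ lam) =
        lam • (auxOp L (signE m n) + lam⁻¹ • ((Complex.I * ξ) • 1)) := by
      rw [smul_add, smul_smul lam, mul_inv_cancel₀ hlam, one_smul]
      simp [auxOp, Kdiag, Matrix.add_kronecker, Matrix.smul_kronecker, add_comm]
    rw [monodromy, e1, e2, e3]
    simp only [smul_mul_assoc, mul_smul_comm, smul_smul]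
    have e4 : (lam ^ (2 * L + 1))⁻¹ * (lam ^ L * (lam * lam ^ L)) = 1 := by
      field_simp
      ring
    rw [e4, one_smul]
  · convert h using 1
    · simp
    · have hs : l.sum = Complex.I • ∑ j : Fin L, permAS j := by
        simp [l, List.sum_ofFn, Finset.smul_sum]
      -- To first order the ordering of the factors is invisible: both rows contribute `i ∑ P_{aj}`,
      -- one to the left of `𝔼_a` and one to its right, which assembles `ℬ_{aj}`.
      rw [List.sum_reverse, hs]
      simp only [calB, Finset.sum_add_distrib, ← Finset.sum_mul, ← Finset.mul_sum, one_mul,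
        mul_one, smul_add, smul_smul, smul_mul_assoc, mul_smul_comm]
      abel

/-- The diagonal entries of `𝔼`. -/
def sgn (m n : ℕ) : Fin m ⊕ Fin n → ℂ := Sum.elim (fun _ => 1) (fun _ => -1)

theorem genb_eq (j : Fin L) (α β : Fin m ⊕ Fin n) :
    genb m n j α β = siteOp j ((sgn m n α + sgn m n β) • Matrix.single β α 1) := by
  rw [genb, calB, auxComp_add, auxComp_mul_auxOp, auxComp_auxOp_mul]
  simp only [auxComp_permAS, signE, Matrix.diagonal_apply, ite_smul, zero_smul,
    Finset.sum_ite_eq, Finset.sum_ite_eq', Finset.mem_univ, if_true]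
  rw [← add_smul, add_comm, ← siteHom_apply, ← siteHom_apply, map_smul]
  rfl

/-- The block-diagonal embedding as a homomorphism of Lie algebras. -/
def blockDiagLie (m n : ℕ) : (Matrix (Fin m) (Fin m) ℂ × Matrix (Fin n) (Fin n) ℂ) →ₗ⁅ℂ⁆
    Matrix (Fin m ⊕ Fin n) (Fin m ⊕ Fin n) ℂ where
  toFun := blockDiag
  map_add' z w := by simp [blockDiag, Matrix.fromBlocks_add]
  map_smul' c z := by simp [blockDiag, Matrix.fromBlocks_smul]
  map_lie' {z w} := by
    simp [blockDiag, Ring.lie_def, Matrix.fromBlocks_multiply, sub_eq_add_neg,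
      Matrix.fromBlocks_neg, Matrix.fromBlocks_add]

theorem blockDiagLie_toLinearMap_apply
    (z : Matrix (Fin m) (Fin m) ℂ × Matrix (Fin n) (Fin n) ℂ) :
    (blockDiagLie m n).toLinearMap z = Matrix.fromBlocks z.1 0 0 z.2 := rfl

theorem blockDiag_injective : Function.Injective (blockDiag (m := m) (n := n)) := by
  intro z w h
  obtain ⟨h1, -, -, h2⟩ := Matrix.fromBlocks_inj.1 h
  exact Prod.ext h1 h2

theorem range_blockDiagLie :
    LinearMap.range (blockDiagLie m n).toLinearMap =
      Submodule.span ℂ {A | ∃ α β, A = (sgn m n α + sgn m n β) • Matrix.single β α (1 : ℂ)} := by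
  apply le_antisymm
  · rintro _ ⟨z, rfl⟩
    rw [Matrix.matrix_eq_sum_single ((blockDiagLie m n).toLinearMap z)]
    refine Submodule.sum_mem _ fun i _ => Submodule.sum_mem _ fun k _ => ?_
    have hmem : (sgn m n k + sgn m n i) • Matrix.single i k (1 : ℂ) ∈ Submodule.span ℂ
        {A | ∃ α β, A = (sgn m n α + sgn m n β) • Matrix.single β α (1 : ℂ)} :=
      Submodule.subset_span ⟨k, i, rfl⟩
    have hscale : ∀ {c : ℂ}, sgn m n k + sgn m n i ≠ 0 → Matrix.single i k c ∈
        Submodule.span ℂ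
          {A | ∃ α β, A = (sgn m n α + sgn m n β) • Matrix.single β α (1 : ℂ)} := by
      intro c hc
      -- Within a block the generator is a nonzero multiple of the matrix unit, so rescaling reaches
      -- any entry `c`.
      have := Submodule.smul_mem _ (c * (sgn m n k + sgn m n i)⁻¹) hmem
      rwa [smul_smul, mul_assoc, inv_mul_cancel₀ hc, mul_one, Matrix.smul_single, smul_eq_mul,
        mul_one] at this
    rcases i with i | i <;> rcases k with k | k
    · exact hscale (by norm_num [sgn])
    · convert Submodule.zero_mem _
      simp [blockDiagLie_toLinearMap_apply]
    · convert Submodule.zero_mem _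
      simp [blockDiagLie_toLinearMap_apply]
    · exact hscale (by norm_num [sgn])
  · rw [Submodule.span_le]
    rintro _ ⟨α, β, rfl⟩
    rcases α with a | a <;> rcases β with b | b
    · refine Submodule.smul_mem _ _ ⟨(Matrix.single b a 1, 0), ?_⟩
      ext (i | i) (k | k) <;> simp [blockDiagLie_toLinearMap_apply, Matrix.single_apply]
    -- Across blocks the signs cancel and the generator is zero.
    · simp [sgn]
    · simp [sgn]
    · refine Submodule.smul_mem _ _ ⟨(0, Matrix.single b a 1), ?_⟩
      ext (i | i) (k | k) <;> simp [blockDiagLie_toLinearMap_apply, Matrix.single_apply]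

/-- Serves both the action at one site (`siteHom`) and the diagonal action (`totalOp`). -/
theorem range_comp_blockDiag {M : Type*} [AddCommGroup M] [Module ℂ M]
    (f : Matrix (Fin m ⊕ Fin n) (Fin m ⊕ Fin n) ℂ →ₗ[ℂ] M) :
    LinearMap.range (f ∘ₗ (blockDiagLie m n).toLinearMap) =
      Submodule.span ℂ
        {A | ∃ α β, A = f ((sgn m n α + sgn m n β) • Matrix.single β α (1 : ℂ))} := by
  rw [LinearMap.range_comp, range_blockDiagLie, Submodule.map_span]
  congr 1
  ext A
  constructor
  · rintro ⟨_, ⟨α, β, rfl⟩, rfl⟩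
    exact ⟨α, β, rfl⟩
  · rintro ⟨α, β, rfl⟩
    exact ⟨_, ⟨α, β, rfl⟩, rfl⟩

theorem Kdiag_commute_blockDiag (ξ lam : ℂ)
    (z : Matrix (Fin m) (Fin m) ℂ × Matrix (Fin n) (Fin n) ℂ) :
    Commute (Kdiag m n ξ lam) (blockDiag z) := by
  refine ((Commute.one_left _).smul_left _).add_left (Commute.smul_left ?_ _)
  ext (i | i) (k | k) <;> simp [signE, blockDiag]

/-- The diagonal action as a homomorphism of Lie algebras. -/
def totalLie (ι : Type) [Fintype ι] [DecidableEq ι] (L : ℕ) : Matrix ι ι ℂ →ₗ⁅ℂ⁆ QOp ι L :=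
  { totalOp ι L with map_lie' := fun {A B} => totalOp_lie A B }

end BlockDiag

end OpenChain

open OpenChain

theorem mainTheorem6 (m n L : ℕ) (ξ : ℂ) :
    -- the `1 / lam` expansion of the monodromy matrix at infinity, entry by entry
    (∀ p q : (Fin m ⊕ Fin n) × (Fin L → Fin m ⊕ Fin n),
      (fun lam : ℂ =>
          (lam ^ (2 * L + 1))⁻¹ * monodromy L (Kdiag m n ξ) lam p q
            - (auxOp L (signE m n)
                + (Complex.I / lam) •
                  (ξ • (1 : AQOp (Fin m ⊕ Fin n) L) + ∑ j : Fin L, calB m n j)) p q)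
        =O[Bornology.cobounded ℂ] fun lam : ℂ => (lam ^ 2)⁻¹) ∧
    -- for each site `j`, the `b_j^{αβ}` realise `gl(m) ⊕ gl(n)` in the space `j`
    (∀ j : Fin L,
      ∃ ρ : (Matrix (Fin m) (Fin m) ℂ × Matrix (Fin n) (Fin n) ℂ) →ₗ⁅ℂ⁆ QOp (Fin m ⊕ Fin n) L,
        (∀ z, ρ z = siteOp j (blockDiag z)) ∧
        Function.Injective ρ ∧
        ρ.range.toSubmodule =
          Submodule.span ℂ {A | ∃ α β : Fin m ⊕ Fin n, A = genb m n j α β}) ∧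
    -- the transfer matrix commutes with the total generators
    (∀ (lam : ℂ) (α β : Fin m ⊕ Fin n),
      ⁅transfer L (fun _ => 1) (Kdiag m n ξ) lam, ∑ j : Fin L, genb m n j α β⁆ = 0) ∧
    -- equivalently, with the algebra `gl(m) ⊕ gl(n)` which the total generators span
    (∃ ρ : (Matrix (Fin m) (Fin m) ℂ × Matrix (Fin n) (Fin n) ℂ) →ₗ⁅ℂ⁆ QOp (Fin m ⊕ Fin n) L,
        (∀ z, ρ z = ∑ j : Fin L, siteOp j (blockDiag z)) ∧
        (1 ≤ L → Function.Injective ρ) ∧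
        ρ.range.toSubmodule =
          Submodule.span ℂ
            {A | ∃ α β : Fin m ⊕ Fin n, A = ∑ j : Fin L, genb m n j α β} ∧
        ∀ (lam : ℂ) (z : Matrix (Fin m) (Fin m) ℂ × Matrix (Fin n) (Fin n) ℂ),
          ⁅transfer L (fun _ => 1) (Kdiag m n ξ) lam, ρ z⁆ = 0) := by
  -- Proved ahead of the other claims because commutation with each total generator follows from it:
  -- the generator lies in the range of `ρ`.
  have htotal : ∃ ρ : (Matrix (Fin m) (Fin m) ℂ × Matrix (Fin n) (Fin n) ℂ) →ₗ⁅ℂ⁆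
        QOp (Fin m ⊕ Fin n) L,
        (∀ z, ρ z = ∑ j : Fin L, siteOp j (blockDiag z)) ∧
        (1 ≤ L → Function.Injective ρ) ∧
        ρ.range.toSubmodule =
          Submodule.span ℂ
            {A | ∃ α β : Fin m ⊕ Fin n, A = ∑ j : Fin L, genb m n j α β} ∧
        ∀ (lam : ℂ) (z : Matrix (Fin m) (Fin m) ℂ × Matrix (Fin n) (Fin n) ℂ),
          ⁅transfer L (fun _ => 1) (Kdiag m n ξ) lam, ρ z⁆ = 0 := by
    refine ⟨(totalLie _ L).comp (blockDiagLie m n), fun z => totalOp_apply _,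
      fun hL => (totalOp_injective hL).comp blockDiag_injective, ?_, fun lam z => ?_⟩
    · simp only [genb_eq, ← totalOp_apply]
      exact range_comp_blockDiag (totalOp _ L)
    · rw [Ring.lie_def, sub_eq_zero]
      exact transfer_commute_totalOp _ lam _ (Kdiag_commute_blockDiag ξ lam z)
  refine ⟨fun p q => ?_, fun j => ?_, fun lam α β => ?_, htotal⟩
  · obtain ⟨G, hG, hlam⟩ := hasExpansion_monodromy m n L ξ
    refine (hG.isBigO p q).congr' ?_ Filter.EventuallyEq.rfl
    -- The rescaled identity holds only for `lam ≠ 0`, which is enough near infinity.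
    filter_upwards [Bornology.eventually_ne_cobounded (0 : ℂ)] with lam h
    rw [← hlam lam h, smul_smul, inv_mul_eq_div]
    rfl
  · refine ⟨(AlgHom.toLieHom (siteHom j)).comp (blockDiagLie m n), fun z => rfl, ?_, ?_⟩
    · exact (siteHom_injective j).comp blockDiag_injective
    · simp only [genb_eq]
      exact range_comp_blockDiag (siteHom j).toLinearMap
  · obtain ⟨ρ, -, -, hrange, hcomm⟩ := htotal
    have hmem : ∑ j : Fin L, genb m n j α β ∈ ρ.range.toSubmodule :=
      hrange ▸ Submodule.subset_span ⟨α, β, rfl⟩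
    obtain ⟨z, hz⟩ := hmem
    rw [← hz]
    exact hcomm lam z
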